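/- Let $\mathbb D$ be the open unit disc, $\mathbb T$ the unit circle, $m$ normalized Lebesgue measure on $\mathbb T$, and let $\mu$ be a Borel probability measure on $\mathbb T$. Let $\xi$ denote the independent variable of $L^2(\mu)$, $M_\xi$ multiplication by $\xi$, $\mathbf 1$ the constant function $1$ and $\bar\xi$ the function $\xi\mapsto\bar\xi$. On $L^2(\mu)$ consider the completely non-unitary contraction $$U_0 = M_\xi-(\,\cdot\,,\bar\xi)_{L^2(\mu)}\mathbf 1,$$ and, for $|\gamma|=1$, its rank one unitary perturbations $$U_\gamma = U_0+\gamma(\,\cdot\,,\bar\xi)_{L^2(\mu)}\mathbf 1 .$$ Let $\mu_\gamma$ be the spectral measure of $U_\gamma$ with respect to the vector $\mathbf 1$, that is, the finite positive Borel measure on $\mathbb T$ with $(f(U_\gamma)\mathbf 1,\mathbf 1)=\int f\,d\mu_\gamma$ for all continuous $f$ on $\mathbb T$; equivalently, $$\big((U_\gamma+zI)(U_\gamma-zI)^{-1}\mathbf 1,\mathbf 1\big)=\int_{\mathbb T}\frac{\xi+z}{\xi-z}\,d\mu_\gamma(\xi)\qquad (z\in\mathbb C\setminus\mathbb T).$$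 Let $(\mu_\gamma)_s$ be the singular part of $\mu_\gamma$ with respect to $m$ (so $(\mu_\gamma)_s$ is carried by a set of Lebesgue measure zero). Let $\theta$ be the characteristic function of $U_0$: with the defect operators $D=(I-U_0^*U_0)^{1/2}$ and $D_*=(I-U_0U_0^*)^{1/2}$ and the characteristic operator function $$\Theta(z)=-U_0+zD_*(I-zU_0^*)^{-1}D\qquad (z\in\mathbb D),$$ the scalar function $\theta$ is given by $\Theta(z)\bar\xi=\theta(z)\mathbf 1$. Then for every $\gamma\in\mathbb T$, for $(\mu_\gamma)_s$-almost every $\zeta\in\mathbb T$, the function $\theta$ has the non-tangential limit $\gamma$ at $\zeta$; that is, for every $a>1$, $$\theta(z)\to\gamma\quad\text{as } z\to\zeta \text{ within } \{z\in\mathbb D:\ |z-\zeta|<a(1-|z|)\}.$$ -/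

import Mathlib

open MeasureTheory Filter Topology
open scoped ENNReal ComplexConjugate InnerProductSpace

noncomputable section

/-- The unit circle carries its Borel sigma-algebra. -/
instance Circle.instMeasurableSpaceBorel : MeasurableSpace Circle := borel Circle

instance Circle.instBorelSpaceBorel : BorelSpace Circle := ⟨rfl⟩

/-- Normalized Lebesgue (arc length) measure `m` on the unit circle. -/
def circleLebesgue : Measure Circle :=
  (ENNReal.ofReal (2 * Real.pi))⁻¹ •
    (volume.restrict (Set.Ioc (-Real.pi) Real.pi)).map Circle.exp

/-- The function `f`, defined on the unit disc, has the non-tangential limit `L` at the boundary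
point `ζ`: in each Stolz region `{z | ‖z‖ < 1, ‖z - ζ‖ < a (1 - ‖z‖)}`, `a > 1`, the values `f z`
tend to `L` as `z → ζ`. -/
def HasNontangentialLimit (f : ℂ → ℂ) (ζ : Circle) (L : ℂ) : Prop :=
  ∀ a : ℝ, 1 < a →
    Tendsto f (𝓝[{z : ℂ | ‖z‖ < 1 ∧ ‖z - (ζ : ℂ)‖ < a * (1 - ‖z‖)}] (ζ : ℂ)) (𝓝 L)

section HilbertSpace

variable {H : Type*} [NormedAddCommGroup H] [InnerProductSpace ℂ H] [CompleteSpace H]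

/-- The defect operator `(I - T^* T)^{1/2}` of a contraction `T`. -/
def defectOperator (T : H →L[ℂ] H) : H →L[ℂ] H := CFC.sqrt (1 - star T * T)

/-- The characteristic operator function
`Θ(z) = -T + z D_* (I - z T^*)⁻¹ D`, `‖z‖ < 1`, of a contraction `T`, where `D` and `D_*` are the
defect operators of `T` and `T^*`. It is to be applied to vectors of the defect space
`closure (range D)`, which it maps into the defect space `closure (range D_*)`. -/
def characteristicOperator (T : H →L[ℂ] H) (z : ℂ) : H →L[ℂ] H :=
  -T + z • (defectOperator (star T) * Ring.inverse (1 - z • star T) * defectOperator T)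

/-- The continuous functional calculus `f ↦ f(U)` of a unitary operator, for continuous functions
on the unit circle. -/
def unitaryCalculus (U : unitary (H →L[ℂ] H)) : C(Circle, ℂ) →⋆ₐ[ℂ] (H →L[ℂ] H) :=
  (cfcHom (R := ℂ) (a := (U : H →L[ℂ] H))
      (Unitary.coe_isStarNormal U)).comp
    (ContinuousMap.compStarAlgHom' ℂ ℂ
      (⟨fun w => ⟨w.1, spectrum.subset_circle_of_unitary U.2 w.2⟩, by fun_prop⟩ :
        C(spectrum ℂ (U : H →L[ℂ] H), Circle)))

/-- A real continuous function on the unit circle, regarded as a complex one. -/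
def complexify (f : C(Circle, ℝ)) : C(Circle, ℂ) := ⟨fun w => (f w : ℂ), by fun_prop⟩

theorem inner_unitaryCalculus_nonneg (U : unitary (H →L[ℂ] H)) (x : H) (f : C(Circle, ℝ))
    (hf : 0 ≤ f) : 0 ≤ (⟪x, unitaryCalculus U (complexify f) x⟫_ℂ).re := by
  let g : C(Circle, ℂ) := ⟨fun w => (Real.sqrt (f w) : ℂ), by fun_prop⟩
  have hg : complexify f = star g * g := by
    ext w
    have h : Real.sqrt (f w) * Real.sqrt (f w) = f w := Real.mul_self_sqrt (hf w)
    simp only [complexify, g, ContinuousMap.coe_mk, ContinuousMap.mul_apply,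
      ContinuousMap.star_apply, RCLike.star_def, Complex.conj_ofReal]
    rw [← Complex.ofReal_mul, h]
  rw [hg, map_mul, map_star, ContinuousLinearMap.star_eq_adjoint,
    ContinuousLinearMap.mul_def, ContinuousLinearMap.comp_apply, ContinuousLinearMap.adjoint_inner_right]
  exact inner_self_nonneg (𝕜 := ℂ)

/-- The positive functional `f ↦ (f(U) x, x)`. -/
def spectralFunctional (U : unitary (H →L[ℂ] H)) (x : H) :
    CompactlySupportedContinuousMap Circle ℝ →ₚ[ℝ] ℝ :=
  PositiveLinearMap.mk₀
    { toFun := fun f => (⟪x, unitaryCalculus U (complexify f.toContinuousMap) x⟫_ℂ).re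
      map_add' := by
        intro f g
        have h : complexify (f + g).toContinuousMap =
            complexify f.toContinuousMap + complexify g.toContinuousMap := by
          ext w
          exact Complex.ofReal_add _ _
        rw [h, map_add, add_apply, inner_add_right, Complex.add_re]
      map_smul' := by
        intro c f
        have h : complexify (c • f).toContinuousMap =
            (c : ℂ) • complexify f.toContinuousMap := by
          ext w
          exact Complex.ofReal_mul _ _
        rw [h, map_smul, smul_apply, inner_smul_right,
          Complex.re_ofReal_mul]
        rfl }
    (fun f hf => inner_unitaryCalculus_nonneg U x f.toContinuousMap hf)

/-- The spectral measure of the unitary operator `U` with respect to the vector `x`: the measure on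
the unit circle with `(f(U) x, x) = ∫ f dν` for all continuous `f`. -/
def spectralMeasure (U : unitary (H →L[ℂ] H)) (x : H) : Measure Circle :=
  RealRMK.rieszMeasure (spectralFunctional U x)

instance spectralMeasure.instIsFiniteMeasure (U : unitary (H →L[ℂ] H)) (x : H) :
    IsFiniteMeasure (spectralMeasure U x) :=
  inferInstanceAs (IsFiniteMeasure (RealRMK.rieszMeasure (spectralFunctional U x)))

theorem integral_spectralMeasure_real (U : unitary (H →L[ℂ] H)) (x : H) (f : C(Circle, ℝ)) :
    ((∫ w, f w ∂(spectralMeasure U x) : ℝ) : ℂ) = ⟪x, unitaryCalculus U (complexify f) x⟫_ℂ := by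
  have h := RealRMK.integral_rieszMeasure (spectralFunctional U x)
    (CompactlySupportedContinuousMap.continuousMapEquiv f)
  have h2 : (∫ w, f w ∂(spectralMeasure U x)) =
      (⟪x, unitaryCalculus U (complexify f) x⟫_ℂ).re := h
  rw [h2]
  have hs : star (unitaryCalculus U (complexify f)) = unitaryCalculus U (complexify f) := by
    rw [← map_star]
    congr 1
    ext w
    simp [complexify]
  have hc : conj ⟪x, unitaryCalculus U (complexify f) x⟫_ℂ =
      ⟪x, unitaryCalculus U (complexify f) x⟫_ℂ := by
    rw [inner_conj_symm]
    nth_rewrite 1 [← hs]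
    rw [ContinuousLinearMap.star_eq_adjoint, ContinuousLinearMap.adjoint_inner_left]
  exact Complex.conj_eq_iff_re.mp hc

theorem integral_spectralMeasure (U : unitary (H →L[ℂ] H)) (x : H) (f : C(Circle, ℂ)) :
    ∫ w, f w ∂(spectralMeasure U x) = ⟪x, unitaryCalculus U f x⟫_ℂ := by
  let u : C(Circle, ℝ) := ⟨fun w => (f w).re, by fun_prop⟩
  let v : C(Circle, ℝ) := ⟨fun w => (f w).im, by fun_prop⟩
  have hf : f = complexify u + Complex.I • complexify v := by
    ext w
    simp only [complexify, u, v, ContinuousMap.coe_mk, ContinuousMap.add_apply,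
      ContinuousMap.smul_apply, smul_eq_mul]
    rw [mul_comm, Complex.re_add_im]
  have hint : Integrable (fun w => f w) (spectralMeasure U x) :=
    f.continuous.integrable_of_hasCompactSupport (HasCompactSupport.of_compactSpace _)
  have h1 := integral_spectralMeasure_real U x u
  have h2 := integral_spectralMeasure_real U x v
  have h3 := integral_re_add_im (𝕜 := ℂ) hint
  rw [← h3]
  have h4 : ⟪x, unitaryCalculus U f x⟫_ℂ =
      ⟪x, unitaryCalculus U (complexify u + Complex.I • complexify v) x⟫_ℂ := by rw [← hf]
  rw [h4, map_add, map_smul, add_apply, smul_apply,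
    inner_add_right, inner_smul_right, ← h1, ← h2, mul_comm Complex.I]
  rfl

theorem unitaryCalculus_coe (U : unitary (H →L[ℂ] H)) :
    unitaryCalculus U ⟨fun w => (w : ℂ), by fun_prop⟩ = (U : H →L[ℂ] H) := by
  have h := cfcHom_id (R := ℂ) (a := (U : H →L[ℂ] H)) (Unitary.coe_isStarNormal U)
  exact h

/-- The formula that characterizes the spectral measure:
`((U + z)(U - z)⁻¹ x, x) = ∫ (w + z) / (w - z) dν(w)` for all `z` off the unit circle. -/
theorem herglotz_spectralMeasure (U : unitary (H →L[ℂ] H)) (x : H) (z : ℂ) (hz : ‖z‖ ≠ 1) :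
    ⟪x, (((U : H →L[ℂ] H) + z • 1) * Ring.inverse ((U : H →L[ℂ] H) - z • 1)) x⟫_ℂ =
      ∫ w : Circle, ((w : ℂ) + z) / ((w : ℂ) - z) ∂(spectralMeasure U x) := by
  have hne : ∀ w : Circle, (w : ℂ) - z ≠ 0 := by
    intro w hw
    apply hz
    rw [← sub_eq_zero.mp hw, Circle.norm_coe]
  let e : C(Circle, ℂ) := ⟨fun w => (w : ℂ), by fun_prop⟩
  let r : C(Circle, ℂ) := ⟨fun w => ((w : ℂ) - z)⁻¹, by fun_prop (disch := exact hne _)⟩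
  have he : unitaryCalculus U e = (U : H →L[ℂ] H) := unitaryCalculus_coe U
  have h1 : (e - z • 1) * r = 1 := by
    ext w
    exact (congrArg (fun t => ((w : ℂ) - t) * ((w : ℂ) - z)⁻¹) (mul_one z)).trans
      (mul_inv_cancel₀ (hne w))
  have h2 := congrArg (unitaryCalculus U) h1
  have h3 := congrArg (unitaryCalculus U) ((mul_comm r (e - z • 1)).trans h1)
  simp only [map_mul, map_sub, map_smul, map_one, he] at h2 h3
  have h4 : Ring.inverse ((U : H →L[ℂ] H) - z • 1) = unitaryCalculus U r :=
    Ring.inverse_unit (⟨_, _, h2, h3⟩ : (H →L[ℂ] H)ˣ)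
  have h5 : (U : H →L[ℂ] H) + z • 1 = unitaryCalculus U (e + z • 1) := by
    simp only [map_add, map_smul, map_one, he]
  rw [h4, h5, ← map_mul, ← integral_spectralMeasure]
  refine integral_congr_ae (Eventually.of_forall fun w => Eq.symm ?_)
  change ((w : ℂ) + z) / ((w : ℂ) - z) = ((w : ℂ) + z * 1) * ((w : ℂ) - z)⁻¹
  rw [mul_one, div_eq_mul_inv]

/-- If the unitary operator `V` maps the unit vector `k` to `l`, then the rank one perturbation
`V + (c - 1) (·, k) l` is unitary for all unimodular `c`. -/
theorem rankOne_perturbation_mem_unitary (V : H →L[ℂ] H) (hV : V ∈ unitary (H →L[ℂ] H)) (k l : H)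
    (hk : ‖k‖ = 1) (hkl : V k = l) (c : Circle) :
    V - InnerProductSpace.rankOne ℂ l k + (c : ℂ) • InnerProductSpace.rankOne ℂ l k ∈
      unitary (H →L[ℂ] H) := by
  set P : H →L[ℂ] H := InnerProductSpace.rankOne ℂ k k with hP
  have hPP : P * P = P := InnerProductSpace.isIdempotentElem_rankOne_self hk
  have hPs : star P = P := by
    rw [ContinuousLinearMap.star_eq_adjoint, hP, InnerProductSpace.adjoint_rankOne]
  have hVP : InnerProductSpace.rankOne ℂ l k = V * P := by
    rw [hP, ContinuousLinearMap.mul_def, InnerProductSpace.comp_rankOne, hkl]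
  have hc : conj (c : ℂ) * (c : ℂ) = 1 := by
    rw [mul_comm, Complex.mul_conj, Circle.normSq_coe, Complex.ofReal_one]
  have hc1 : conj (c : ℂ) • (c : ℂ) • P = P := by rw [smul_smul, hc, one_smul]
  have hc2 : (c : ℂ) • conj (c : ℂ) • P = P := by rw [smul_smul, mul_comm, hc, one_smul]
  have hW : (1 - P + (c : ℂ) • P) ∈ unitary (H →L[ℂ] H) := by
    rw [Unitary.mem_iff]
    simp only [star_add, star_sub, star_one, hPs, star_smul, RCLike.star_def]
    constructor
    all_goals
      simp only [mul_add, add_mul, mul_sub, sub_mul, one_mul, mul_one, smul_mul_assoc,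
        mul_smul_comm, hPP]
      simp [hc1, hc2]
  have h := mul_mem hV hW
  rw [hVP]
  convert h using 1
  simp only [mul_add, mul_sub, mul_one, mul_smul_comm]

/-- The defect operators of `V - (·, k) l` are the orthogonal projections onto the lines spanned by
`k` and by `l`. -/
theorem defectOperator_rankOne_perturbation (V : H →L[ℂ] H) (hV : V ∈ unitary (H →L[ℂ] H))
    (k l : H) (hk : ‖k‖ = 1) (hkl : V k = l) :
    defectOperator (V - InnerProductSpace.rankOne ℂ l k) = InnerProductSpace.rankOne ℂ k k ∧
      defectOperator (star (V - InnerProductSpace.rankOne ℂ l k)) =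
        InnerProductSpace.rankOne ℂ l l := by
  obtain ⟨hV1, hV2⟩ := Unitary.mem_iff.mp hV
  set P : H →L[ℂ] H := InnerProductSpace.rankOne ℂ k k with hP
  have hPP : P * P = P := InnerProductSpace.isIdempotentElem_rankOne_self hk
  have hPs : star P = P := by
    rw [ContinuousLinearMap.star_eq_adjoint, hP, InnerProductSpace.adjoint_rankOne]
  have hVP : InnerProductSpace.rankOne ℂ l k = V * P := by
    rw [hP, ContinuousLinearMap.mul_def, InnerProductSpace.comp_rankOne, hkl]
  have hPV : InnerProductSpace.rankOne ℂ k l = P * star V := by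
    have h := congrArg star hVP
    rwa [star_mul, hPs, ContinuousLinearMap.star_eq_adjoint, InnerProductSpace.adjoint_rankOne]
      at h
  have hQ : InnerProductSpace.rankOne ℂ l l = V * P * star V := by
    rw [mul_assoc, ← hPV, ContinuousLinearMap.mul_def, InnerProductSpace.comp_rankOne, hkl]
  have key1 : star (V - V * P) * (V - V * P) = 1 - P := by
    have h : V - V * P = V * (1 - P) := by rw [mul_sub, mul_one]
    rw [h, star_mul, star_sub, star_one, hPs, mul_assoc, ← mul_assoc (star V), hV1, one_mul,
      mul_sub, sub_mul, sub_mul, hPP]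
    simp
  have key2 : (V - V * P) * star (V - V * P) = 1 - V * P * star V := by
    have h : V - V * P = V * (1 - P) := by rw [mul_sub, mul_one]
    have h' : (1 - P) * (1 - P) = 1 - P := by
      rw [mul_sub, sub_mul, sub_mul, hPP]
      simp
    rw [h, star_mul, star_sub, star_one, hPs, mul_assoc, ← mul_assoc (1 - P), h', sub_mul,
      one_mul, mul_sub, hV2, mul_assoc]
  have hP0 : 0 ≤ P := by
    have h := star_mul_self_nonneg P
    rwa [hPs, hPP] at h
  have hQ0 : 0 ≤ V * P * star V := star_right_conjugate_nonneg hP0 V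
  rw [hQ, hVP]
  constructor
  · rw [defectOperator, key1, sub_sub_cancel]
    exact CFC.sqrt_unique hPP
  · rw [defectOperator, star_star, key2, sub_sub_cancel]
    refine CFC.sqrt_unique ?_
    calc V * P * star V * (V * P * star V) = V * P * (star V * V) * P * star V := by
          simp only [mul_assoc]
      _ = V * P * star V := by rw [hV1, mul_one, mul_assoc V, hPP]

end HilbertSpace

section RankOne

variable (μ : Measure Circle) [IsProbabilityMeasure μ]

/-- The constant function `1` in `L²(μ)`. -/
def oneVec : Lp ℂ 2 μ := ContinuousMap.toLp 2 μ ℂ (1 : C(Circle, ℂ))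

/-- The function `ξ ↦ conj ξ` in `L²(μ)`. -/
def conjVec : Lp ℂ 2 μ :=
  ContinuousMap.toLp 2 μ ℂ (⟨fun w => conj (w : ℂ), by fun_prop⟩ : C(Circle, ℂ))

/-- The operator of multiplication by a continuous function on `L²(μ)`. -/
def multiplication (f : C(Circle, ℂ)) : Lp ℂ 2 μ →L[ℂ] Lp ℂ 2 μ :=
  (ContinuousLinearMap.mul ℂ ℂ).holderL μ ∞ 2 2 (ContinuousMap.toLp ∞ μ ℂ f)

/-- The operator of multiplication by the independent variable on `L²(μ)`. -/
def multiplicationCoe : Lp ℂ 2 μ →L[ℂ] Lp ℂ 2 μ :=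
  multiplication μ ⟨fun w => (w : ℂ), by fun_prop⟩

theorem coeFn_multiplication (f : C(Circle, ℂ)) (g : Lp ℂ 2 μ) :
    multiplication μ f g =ᵐ[μ] fun w => f w * g w := by
  have h1 := (ContinuousLinearMap.mul ℂ ℂ).coeFn_holder (r := 2) (ContinuousMap.toLp ∞ μ ℂ f) g
  have h2 := ContinuousMap.coeFn_toLp (p := ∞) (𝕜 := ℂ) μ f
  filter_upwards [h1, h2] with w hw1 hw2
  rw [hw2] at hw1
  exact hw1

theorem multiplication_mul (f g : C(Circle, ℂ)) :
    multiplication μ f * multiplication μ g = multiplication μ (f * g) := by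
  ext1 h
  refine Lp.ext ?_
  filter_upwards [coeFn_multiplication μ f (multiplication μ g h), coeFn_multiplication μ g h,
    coeFn_multiplication μ (f * g) h] with w h1 h2 h3
  rw [h3, ContinuousMap.mul_apply, mul_assoc, ← h2, ← h1]
  rfl

theorem multiplication_one : multiplication μ 1 = 1 := by
  ext1 h
  refine Lp.ext ?_
  filter_upwards [coeFn_multiplication μ 1 h] with w h1
  rw [h1]
  exact one_mul _

theorem star_multiplication (f : C(Circle, ℂ)) :
    star (multiplication μ f) = multiplication μ (star f) := by
  rw [ContinuousLinearMap.star_eq_adjoint, eq_comm, ContinuousLinearMap.eq_adjoint_iff]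
  intro g h
  rw [L2.inner_def, L2.inner_def]
  refine integral_congr_ae ?_
  filter_upwards [coeFn_multiplication μ (star f) g, coeFn_multiplication μ f h] with w h1 h2
  rw [h1, h2]
  simp only [RCLike.inner_apply, ContinuousMap.star_apply, RCLike.star_def, map_mul,
    RingHomCompTriple.comp_apply, RingHom.id_apply]
  ring

theorem multiplicationCoe_mem_unitary :
    multiplicationCoe μ ∈ unitary (Lp ℂ 2 μ →L[ℂ] Lp ℂ 2 μ) := by
  have h : star (⟨fun w => (w : ℂ), by fun_prop⟩ : C(Circle, ℂ)) *
      (⟨fun w => (w : ℂ), by fun_prop⟩ : C(Circle, ℂ)) = 1 := by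
    ext w
    change conj (w : ℂ) * (w : ℂ) = 1
    rw [mul_comm, Complex.mul_conj, Circle.normSq_coe, Complex.ofReal_one]
  rw [Unitary.mem_iff, multiplicationCoe, star_multiplication, multiplication_mul,
    multiplication_mul, mul_comm _ (star _), h, multiplication_one]
  exact ⟨rfl, rfl⟩

theorem multiplicationCoe_conjVec : multiplicationCoe μ (conjVec μ) = oneVec μ := by
  refine Lp.ext ?_
  filter_upwards [coeFn_multiplication μ ⟨fun w => (w : ℂ), by fun_prop⟩ (conjVec μ),
    ContinuousMap.coeFn_toLp (p := 2) (𝕜 := ℂ) μ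
      (⟨fun w => conj (w : ℂ), by fun_prop⟩ : C(Circle, ℂ)),
    ContinuousMap.coeFn_toLp (p := 2) (𝕜 := ℂ) μ (1 : C(Circle, ℂ))] with w h1 h2 h3
  rw [multiplicationCoe, h1, oneVec, h3, conjVec, h2]
  change (w : ℂ) * conj (w : ℂ) = 1
  rw [Complex.mul_conj, Circle.normSq_coe, Complex.ofReal_one]

theorem norm_oneVec : ‖oneVec μ‖ = 1 := by
  have h : ⟪oneVec μ, oneVec μ⟫_ℂ = 1 := by
    rw [L2.inner_def]
    have h2 : ∀ᵐ w ∂μ, ⟪oneVec μ w, oneVec μ w⟫_ℂ = 1 := by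
      filter_upwards [ContinuousMap.coeFn_toLp (p := 2) (𝕜 := ℂ) μ (1 : C(Circle, ℂ))] with w hw
      rw [oneVec, hw]
      simp
    rw [integral_congr_ae h2]
    simp
  rw [norm_eq_sqrt_re_inner (𝕜 := ℂ), h]
  simp

theorem norm_conjVec : ‖conjVec μ‖ = 1 := by
  rw [← norm_oneVec μ, ← multiplicationCoe_conjVec]
  exact (ContinuousLinearMap.norm_map_of_mem_unitary (multiplicationCoe_mem_unitary μ) _).symm

/-- The completely non-unitary contraction `U_0 = M_ξ - (·, conj ξ) 1` on `L²(μ)`. -/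
def cnuContraction : Lp ℂ 2 μ →L[ℂ] Lp ℂ 2 μ :=
  multiplicationCoe μ - InnerProductSpace.rankOne ℂ (oneVec μ) (conjVec μ)

/-- The rank one unitary perturbation `U_γ = U_0 + γ (·, conj ξ) 1` of `U_0`, for unimodular
`γ`. -/
def rankOnePerturbation (γ : Circle) : unitary (Lp ℂ 2 μ →L[ℂ] Lp ℂ 2 μ) :=
  ⟨cnuContraction μ + (γ : ℂ) • InnerProductSpace.rankOne ℂ (oneVec μ) (conjVec μ),
    rankOne_perturbation_mem_unitary (multiplicationCoe μ) (multiplicationCoe_mem_unitary μ)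
      (conjVec μ) (oneVec μ) (norm_conjVec μ) (multiplicationCoe_conjVec μ) γ⟩

/-- The spectral measure `μ_γ` of `U_γ` with respect to the cyclic vector `1`. -/
def perturbedMeasure (γ : Circle) : Measure Circle :=
  spectralMeasure (rankOnePerturbation μ γ) (oneVec μ)

/-- The characteristic function `θ` of `U_0`: the scalar with `Θ(z) (conj ξ) = θ(z) 1`, see
`characteristicOperator_conjVec`. -/
def characteristicFunction (z : ℂ) : ℂ :=
  ⟪oneVec μ, characteristicOperator (cnuContraction μ) z (conjVec μ)⟫_ℂ

theorem characteristicOperator_conjVec (z : ℂ) :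
    characteristicOperator (cnuContraction μ) z (conjVec μ) =
      characteristicFunction μ z • oneVec μ := by
  have hT : cnuContraction μ (conjVec μ) = 0 := by
    have h : cnuContraction μ (conjVec μ) = multiplicationCoe μ (conjVec μ) -
        ⟪conjVec μ, conjVec μ⟫_ℂ • oneVec μ := rfl
    rw [h, multiplicationCoe_conjVec, inner_self_eq_norm_sq_to_K, norm_conjVec]
    simp
  have hD := (defectOperator_rankOne_perturbation (multiplicationCoe μ)
    (multiplicationCoe_mem_unitary μ) (conjVec μ) (oneVec μ) (norm_conjVec μ)
    (multiplicationCoe_conjVec μ)).2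
  obtain ⟨c, hc⟩ : ∃ c : ℂ,
      characteristicOperator (cnuContraction μ) z (conjVec μ) = c • oneVec μ := by
    refine ⟨z * ⟪oneVec μ, Ring.inverse (1 - z • star (cnuContraction μ))
      (defectOperator (cnuContraction μ) (conjVec μ))⟫_ℂ, ?_⟩
    have h : characteristicOperator (cnuContraction μ) z (conjVec μ) =
        -(cnuContraction μ (conjVec μ)) + z • (defectOperator (star (cnuContraction μ))
          (Ring.inverse (1 - z • star (cnuContraction μ))
            (defectOperator (cnuContraction μ) (conjVec μ)))) := rfl
    rw [h, hT, neg_zero, zero_add, mul_smul]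
    congr 1
    rw [cnuContraction, hD]
    rfl
  rw [characteristicFunction, hc, inner_smul_right, inner_self_eq_norm_sq_to_K, norm_oneVec]
  simp

end RankOne

end

/-! Let `F` be the Herglotz integral of `ν = μ_γ`. A resolvent computation gives the Cayley relation
`(1 - conj γ θ)(1 + F) = 2` (`one_sub_characteristicFunction_mul`), hence `|θ - γ| = 2 / |1 + F| ≤ 2
/ Re F` wherever `Re F > 0`. It remains to see that `Re F → ∞` in Stolz regions.

`Re F` is the Poisson integral of `ν`. For `z` in a Stolz region at `ζ` and `r = 1 - |z|`, the
Poisson kernel is at least a constant times `1 / r` on the arc of radius `r` about `ζ`, so `Re F`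
dominates `ν(arc) / r` (`measureReal_closedBall_div_le_re_herglotz`). Since `ν` dominates its
singular part, and a singular measure has infinite density almost everywhere with respect to itself
(`ae_eventually_mul_le_measureReal_closedBall`), this tends to infinity. -/

/-! ### Densities of singular measures on the circle. -/

instance circleLebesgue.instIsFiniteMeasure : IsFiniteMeasure circleLebesgue := by
  have h : (ENNReal.ofReal (2 * Real.pi))⁻¹ ≠ ∞ := by
    simpa using Real.pi_pos
  have : IsFiniteMeasure (volume.restrict (Set.Ioc (-Real.pi) Real.pi)) :=
    ⟨by simp⟩
  exact Measure.smul_finite _ h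

theorem Circle.dist_eq_norm_coe_sub (x y : Circle) : dist x y = ‖(x : ℂ) - y‖ :=
  dist_eq_norm (x : ℂ) y

theorem dist_circleExp_le (s t : ℝ) : dist (Circle.exp s) (Circle.exp t) ≤ |s - t| := by
  have h : ((Circle.exp s : Circle) : ℂ) - Circle.exp t =
      (Circle.exp t : ℂ) * (Complex.exp (Complex.I * ((s - t : ℝ) : ℂ)) - 1) := by
    rw [Circle.coe_exp, Circle.coe_exp, mul_sub, ← Complex.exp_add, mul_one]
    congr 2
    push_cast
    ring
  rw [Circle.dist_eq_norm_coe_sub, h, norm_mul, Circle.norm_coe, one_mul]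
  exact Real.norm_exp_I_mul_ofReal_sub_one_le

/-- Arcs of radius `r` have Lebesgue measure at least `r / (2 π)`. -/
theorem le_circleLebesgue_closedBall (ζ : Circle) {r : ℝ} (hr : r ≤ Real.pi) :
    (ENNReal.ofReal (2 * Real.pi))⁻¹ * ENNReal.ofReal r ≤
      circleLebesgue (Metric.closedBall ζ r) := by
  rw [circleLebesgue, Measure.smul_apply, smul_eq_mul]
  gcongr
  rw [Measure.map_apply Circle.exp.continuous.measurable Metric.isClosed_closedBall.measurableSet,
    Measure.restrict_apply
      (Circle.exp.continuous.measurable Metric.isClosed_closedBall.measurableSet)]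
  have h1 := Complex.neg_pi_lt_arg (ζ : ℂ)
  have h2 := Complex.arg_le_pi (ζ : ℂ)
  have h3 : Circle.exp (Complex.arg ζ) = ζ := Circle.exp_arg ζ
  set t := Complex.arg (ζ : ℂ)
  -- The half-arc on the side of `t` towards `0` stays inside the parameter interval `(-π, π]`
  -- because `r ≤ π`; one half suffices.
  rcases le_total 0 t with ht | ht
  · calc ENNReal.ofReal r = volume (Set.Ioc (t - r) t) := by rw [Real.volume_Ioc]; simp
      _ ≤ _ := by
        refine measure_mono fun s hs => ⟨?_, ?_, ?_⟩
        · rw [Set.mem_preimage, Metric.mem_closedBall, ← h3]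
          refine (dist_circleExp_le s t).trans ?_
          rw [abs_le]
          constructor <;> linarith [hs.1, hs.2]
        · linarith [hs.1]
        · linarith [hs.2]
  · calc ENNReal.ofReal r = volume (Set.Ioc t (t + r)) := by rw [Real.volume_Ioc]; simp
      _ ≤ _ := by
        refine measure_mono fun s hs => ⟨?_, ?_, ?_⟩
        · rw [Set.mem_preimage, Metric.mem_closedBall, ← h3]
          refine (dist_circleExp_le s t).trans ?_
          rw [abs_le]
          constructor <;> linarith [hs.1, hs.2]
        · linarith [hs.1]
        · linarith [hs.2]

theorem Circle.measurableEmbedding_coeHom : MeasurableEmbedding Circle.coeHom := by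
  have h : Continuous Circle.coeHom := by fun_prop
  exact (h.isClosedEmbedding Circle.coe_injective).measurableEmbedding

/-- Differentiation of measures on the circle. -/
theorem Circle.ae_tendsto_rnDeriv (ρ σ : Measure Circle) [IsFiniteMeasure ρ] [IsFiniteMeasure σ] :
    ∀ᵐ ζ ∂σ, Tendsto (fun r => ρ (Metric.closedBall ζ r) / σ (Metric.closedBall ζ r)) (𝓝[>] 0)
      (𝓝 (ρ.rnDeriv σ ζ)) := by
  -- Balls of the circle are traces of balls of `ℂ`, so differentiation in the plane transfers
  -- through the pushforward.
  have h := Besicovitch.ae_tendsto_rnDeriv (ρ.map Circle.coeHom) (σ.map Circle.coeHom)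
  rw [Circle.measurableEmbedding_coeHom.ae_map_iff] at h
  filter_upwards [h, Circle.measurableEmbedding_coeHom.rnDeriv_map ρ σ] with ζ h1 h2
  rw [h2] at h1
  simp only [Circle.measurableEmbedding_coeHom.map_apply] at h1
  exact h1

/-- A measure on the circle that is singular with respect to the Lebesgue measure has infinite
density almost everywhere. -/
theorem ae_eventually_mul_le_measureReal_closedBall (σ : Measure Circle) [IsFiniteMeasure σ]
    (hσ : circleLebesgue ⟂ₘ σ) :
    ∀ᵐ ζ ∂σ, ∀ M : ℝ, ∀ᶠ r in 𝓝[>] (0 : ℝ), M * r ≤ σ.real (Metric.closedBall ζ r) := by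
  -- Lebesgue measure is differentiated against `σ`, not conversely: this quotient tends to `0` at
  -- `σ`-almost every point, while its numerator is at least of order `r`.
  filter_upwards [Circle.ae_tendsto_rnDeriv circleLebesgue σ,
    Measure.rnDeriv_eq_zero_of_mutuallySingular hσ Measure.AbsolutelyContinuous.rfl]
    with ζ h1 h2 M
  rw [h2] at h1
  rcases le_or_gt M 0 with hM | hM
  · filter_upwards [self_mem_nhdsWithin] with r hr
    exact (mul_nonpos_of_nonpos_of_nonneg hM (le_of_lt hr)).trans measureReal_nonneg
  have hπ := Real.pi_pos
  -- The `2π` cancels the constant in `le_circleLebesgue_closedBall`.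
  have hε : (0 : ℝ≥0∞) < ENNReal.ofReal (2 * Real.pi * M)⁻¹ := by
    rw [ENNReal.ofReal_pos]; positivity
  filter_upwards [h1.eventually_lt_const hε, Ioc_mem_nhdsGT hπ] with r hr1 hr2
  have hr0 : 0 < r := hr2.1
  have h3 := le_circleLebesgue_closedBall ζ hr2.2
  have hpos : 0 < circleLebesgue (Metric.closedBall ζ r) := by
    refine lt_of_lt_of_le (ENNReal.mul_pos ?_ ?_) h3
    · exact ENNReal.inv_ne_zero.mpr ENNReal.ofReal_ne_top
    · simpa using hr0
  have h4 : circleLebesgue (Metric.closedBall ζ r) ≤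
      ENNReal.ofReal (2 * Real.pi * M)⁻¹ * σ (Metric.closedBall ζ r) :=
    (ENNReal.div_le_iff_le_mul (Or.inr ENNReal.ofReal_ne_top) (Or.inr hε.ne')).mp hr1.le
  have h5 := ENNReal.toReal_mono (ENNReal.mul_ne_top ENNReal.ofReal_ne_top (measure_ne_top _ _))
    (h3.trans h4)
  rw [ENNReal.toReal_mul, ENNReal.toReal_mul, ENNReal.toReal_inv,
    ENNReal.toReal_ofReal (by positivity), ENNReal.toReal_ofReal hr0.le,
    ENNReal.toReal_ofReal (by positivity), mul_inv (2 * Real.pi) M, mul_assoc] at h5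
  have h6 : r ≤ M⁻¹ * σ.real (Metric.closedBall ζ r) :=
    le_of_mul_le_mul_left h5 (by positivity)
  rwa [inv_mul_eq_div, le_div_iff₀ hM, mul_comm] at h6

/-! ### The Poisson kernel in a Stolz region. -/

theorem Complex.re_add_div_sub (w : Circle) (z : ℂ) :
    (((w : ℂ) + z) / ((w : ℂ) - z)).re = (1 - ‖z‖ ^ 2) / ‖(w : ℂ) - z‖ ^ 2 := by
  have hw : (w : ℂ).re * (w : ℂ).re + (w : ℂ).im * (w : ℂ).im = 1 := by
    rw [← Complex.normSq_apply, Circle.normSq_coe]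
  rw [Complex.div_re, ← Complex.normSq_eq_norm_sq, ← Complex.normSq_eq_norm_sq, ← add_div]
  congr 1
  rw [Complex.normSq_apply]
  simp only [Complex.add_re, Complex.sub_re, Complex.add_im, Complex.sub_im]
  linear_combination hw

/-- In a Stolz region the Poisson integral dominates the averages over arcs. -/
theorem measureReal_closedBall_div_le_re_herglotz (ν : Measure Circle) [IsFiniteMeasure ν]
    (ζ : Circle) {a : ℝ} {z : ℂ} (hz : ‖z‖ < 1)
    (hza : ‖z - (ζ : ℂ)‖ < a * (1 - ‖z‖)) :
    ν.real (Metric.closedBall ζ (1 - ‖z‖)) / ((1 + a) ^ 2 * (1 - ‖z‖)) ≤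
      (∫ w : Circle, ((w : ℂ) + z) / ((w : ℂ) - z) ∂ν).re := by
  have hr : 0 < 1 - ‖z‖ := by linarith
  have hne : ∀ w : Circle, (w : ℂ) - z ≠ 0 := by
    intro w hw
    have h := Circle.norm_coe w
    rw [sub_eq_zero.mp hw] at h
    exact hz.ne h
  have hint : Integrable (fun w : Circle => ((w : ℂ) + z) / ((w : ℂ) - z)) ν := by
    have hc : Continuous fun w : Circle => ((w : ℂ) + z) / ((w : ℂ) - z) := by
      fun_prop (disch := exact hne _)
    exact hc.integrable_of_hasCompactSupport (HasCompactSupport.of_compactSpace _)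
  have hre : (∫ w : Circle, ((w : ℂ) + z) / ((w : ℂ) - z) ∂ν).re =
      ∫ w : Circle, (((w : ℂ) + z) / ((w : ℂ) - z)).re ∂ν :=
    (integral_re (𝕜 := ℂ) hint).symm
  have hB : MeasurableSet (Metric.closedBall ζ (1 - ‖z‖)) :=
    Metric.isClosed_closedBall.measurableSet
  rw [hre, div_eq_mul_inv, ← smul_eq_mul, ← integral_indicator_const _ hB]
  refine integral_mono ((integrable_const _).indicator hB) hint.re fun w => ?_
  have hnn : 0 ≤ 1 - ‖z‖ ^ 2 := by nlinarith [norm_nonneg z]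
  change _ ≤ (((w : ℂ) + z) / ((w : ℂ) - z)).re
  rw [Complex.re_add_div_sub]
  refine Set.indicator_apply_le' (fun hw => ?_) fun _ => by positivity
  -- Triangle inequality through `ζ`: the arc contributes `1`, the Stolz condition `a`.
  have hd : ‖(w : ℂ) - z‖ ≤ (1 + a) * (1 - ‖z‖) := by
    have h1 : ‖(w : ℂ) - ζ‖ ≤ 1 - ‖z‖ := by
      rw [← dist_eq_norm]
      exact hw
    have h2 := norm_sub_le_norm_sub_add_norm_sub (w : ℂ) ζ z
    rw [norm_sub_rev (ζ : ℂ) z] at h2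
    linarith
  have hpos : 0 < ‖(w : ℂ) - z‖ := norm_pos_iff.mpr (hne w)
  have ha : 0 < 1 + a := by
    have := hpos.trans_le hd
    exact pos_of_mul_pos_left this hr.le
  rw [inv_eq_one_div, div_le_div_iff₀ (by positivity) (by positivity), one_mul]
  calc ‖(w : ℂ) - z‖ ^ 2 ≤ ((1 + a) * (1 - ‖z‖)) ^ 2 := by gcongr
    _ = (1 - ‖z‖) * ((1 + a) ^ 2 * (1 - ‖z‖)) := by ring
    _ ≤ (1 - ‖z‖ ^ 2) * ((1 + a) ^ 2 * (1 - ‖z‖)) := by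
      gcongr
      nlinarith [norm_nonneg z]

/-! ### Resolvents of rank one perturbations. -/

section HilbertSpace

variable {H : Type*} [NormedAddCommGroup H] [InnerProductSpace ℂ H] [CompleteSpace H]

theorem isUnit_one_sub_smul_star {T : H →L[ℂ] H} (hT : ‖T‖ ≤ 1) {z : ℂ} (hz : ‖z‖ < 1) :
    IsUnit (1 - z • star T) := by
  refine isUnit_one_sub_of_norm_lt_one ?_
  rw [norm_smul, norm_star]
  exact (mul_le_of_le_one_right (norm_nonneg z) hT).trans_lt hz

theorem norm_le_one_of_mem_unitary {U : H →L[ℂ] H} (hU : U ∈ unitary (H →L[ℂ] H)) : ‖U‖ ≤ 1 :=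
  ContinuousLinearMap.opNorm_le_bound _ zero_le_one fun x => by
    rw [ContinuousLinearMap.norm_map_of_mem_unitary hU, one_mul]

/-- `T` is the midpoint of two unitaries. -/
theorem norm_le_one_of_add_mem_unitary {T R : H →L[ℂ] H} (h1 : T + R ∈ unitary (H →L[ℂ] H))
    (h2 : T - R ∈ unitary (H →L[ℂ] H)) : ‖T‖ ≤ 1 := by
  have h : (2 : ℂ) • T = (T + R) + (T - R) := by rw [two_smul]; abel
  have h3 := norm_add_le (T + R) (T - R)
  rw [← h, norm_smul, Complex.norm_ofNat] at h3
  linarith [norm_le_one_of_mem_unitary h1, norm_le_one_of_mem_unitary h2]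

/-- The characteristic function of `T` and the Herglotz integral of its unitary perturbation
`U = T + c (·, k) l`, where `U k = c l`, are related by a Cayley transform. -/
theorem one_sub_characteristic_mul_one_add_herglotz {T U : H →L[ℂ] H} {k l : H} {c z : ℂ}
    (hT : ‖T‖ ≤ 1) (hU : U ∈ unitary (H →L[ℂ] H))
    (hUT : U = T + c • InnerProductSpace.rankOne ℂ l k)
    (hc : conj c * c = 1) (hl : ‖l‖ = 1) (hUk : U k = c • l) (hz : ‖z‖ < 1) :
    (1 - conj c * (z * ⟪l, Ring.inverse (1 - z • star T) k⟫_ℂ)) *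
      (1 + ⟪l, ((U + z • 1) * Ring.inverse (U - z • 1)) l⟫_ℂ) = 2 := by
  obtain ⟨hU1, hU2⟩ := Unitary.mem_iff.mp hU
  have hunit := isUnit_one_sub_smul_star (norm_le_one_of_mem_unitary hU) hz
  have hUz : U - z • 1 = U * (1 - z • star U) := by
    rw [mul_sub, mul_one, mul_smul_comm, hU2]
  have hunit2 : IsUnit (U - z • 1) := by
    rw [hUz]
    exact IsUnit.mul ⟨⟨U, star U, hU2, hU1⟩, rfl⟩ hunit
  set x := Ring.inverse (1 - z • star T) k with hx
  set y := Ring.inverse (U - z • 1) l with hy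
  have hx1 : x - z • star T x = k := by
    have h := congrArg (fun A : H →L[ℂ] H => A k)
      (Ring.mul_inverse_cancel _ (isUnit_one_sub_smul_star hT hz))
    exact h
  have hy1 : U y - z • y = l := by
    have h := congrArg (fun A : H →L[ℂ] H => A l) (Ring.mul_inverse_cancel _ hunit2)
    exact h
  have hsU : ∀ v, star U (U v) = v := fun v => congrArg (fun A : H →L[ℂ] H => A v) hU1
  -- The adjoints differ by an operator with range in the line of `k`, so the resolvents of `star T`
  -- and `star U` applied to `k` are parallel.
  have hTstar : star T x = star U x - (conj c * ⟪l, x⟫_ℂ) • k := by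
    have h : star U = star T + conj c • InnerProductSpace.rankOne ℂ k l := by
      rw [hUT, star_add, star_smul, ContinuousLinearMap.star_eq_adjoint
        (InnerProductSpace.rankOne ℂ l k), InnerProductSpace.adjoint_rankOne, RCLike.star_def]
    rw [h, add_apply, smul_apply, InnerProductSpace.rankOne_apply, mul_smul, add_sub_cancel_right]
  have hk : k = c • star U l := by
    rw [← map_smul, ← hUk, hsU]
  have hy2 : y - z • star U y = star U l := by
    rw [← hy1, map_sub, map_smul, hsU]
  set θ := z * ⟪l, x⟫_ℂ with hθ
  have hx2 : x - z • star U x = (1 - conj c * θ) • k := by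
    rw [hTstar] at hx1
    have h : conj c * θ = z * (conj c * ⟪l, x⟫_ℂ) := by rw [hθ]; ring
    rw [h, ← sub_eq_zero]
    rw [← sub_eq_zero] at hx1
    rw [← hx1]
    module
  -- Both sides have the same image under the invertible `1 - z • star U`.
  have hxy : x = ((1 - conj c * θ) * c) • y := by
    have hinj : Function.Injective (1 - z • star U : H →L[ℂ] H) := by
      obtain ⟨u, hu⟩ := hunit
      rw [← hu]
      refine Function.LeftInverse.injective (g := ((u⁻¹ : (H →L[ℂ] H)ˣ) : H →L[ℂ] H)) fun v => ?_
      exact congrArg (fun A : H →L[ℂ] H => A v) u.inv_mul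
    apply hinj
    rw [map_smul]
    change x - z • star U x = ((1 - conj c * θ) * c) • (y - z • star U y)
    rw [hx2, hy2, mul_smul, ← hk]
  have hF : ⟪l, ((U + z • 1) * Ring.inverse (U - z • 1)) l⟫_ℂ = 1 + 2 * (z * ⟪l, y⟫_ℂ) := by
    have h : ((U + z • 1) * Ring.inverse (U - z • 1)) l = l + (2 * z) • y := by
      change U y + z • y = _
      rw [← sub_eq_zero, ← hy1]
      module
    rw [h, inner_add_right, inner_smul_right, inner_self_eq_norm_sq_to_K, hl]
    push_cast
    ring
  -- Pairing `hxy` with `l` makes it a scalar equation; multiplied by `2 * conj c`, it turns `(1 -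
  -- conj c * θ) * (2 + 2 * (z * ⟪l, y⟫_ℂ))` into `2`.
  have hθy : θ = (1 - conj c * θ) * c * (z * ⟪l, y⟫_ℂ) := by
    rw [hθ]
    nth_rewrite 1 [hxy]
    rw [inner_smul_right]
    ring
  rw [hF]
  linear_combination (-2 * conj c) * hθy - 2 * (1 - conj c * θ) * (z * ⟪l, y⟫_ℂ) * hc

end HilbertSpace

/-! ### The characteristic function and the Clark identity. -/

section RankOne

variable (μ : Measure Circle) [IsProbabilityMeasure μ]

theorem norm_cnuContraction_le_one : ‖cnuContraction μ‖ ≤ 1 := by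
  refine norm_le_one_of_add_mem_unitary
    (R := InnerProductSpace.rankOne ℂ (oneVec μ) (conjVec μ)) ?_ ?_
  · simpa [rankOnePerturbation] using (rankOnePerturbation μ 1).2
  · simpa [rankOnePerturbation, ← sub_eq_add_neg] using (rankOnePerturbation μ (-1)).2

theorem cnuContraction_conjVec : cnuContraction μ (conjVec μ) = 0 := by
  rw [cnuContraction, sub_apply, InnerProductSpace.rankOne_apply, multiplicationCoe_conjVec,
    inner_self_eq_norm_sq_to_K, norm_conjVec]
  simp

/-- `U_0` annihilates `conjVec`, and the defect operators are the projections onto the lines of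
`conjVec` and `oneVec`; only a matrix entry of the resolvent survives. -/
theorem characteristicFunction_eq (z : ℂ) :
    characteristicFunction μ z =
      z * ⟪oneVec μ, Ring.inverse (1 - z • star (cnuContraction μ)) (conjVec μ)⟫_ℂ := by
  have hD := defectOperator_rankOne_perturbation (multiplicationCoe μ)
    (multiplicationCoe_mem_unitary μ) (conjVec μ) (oneVec μ) (norm_conjVec μ)
    (multiplicationCoe_conjVec μ)
  have h1 : defectOperator (cnuContraction μ) (conjVec μ) = conjVec μ := by
    rw [cnuContraction, hD.1, InnerProductSpace.rankOne_apply, inner_self_eq_norm_sq_to_K,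
      norm_conjVec]
    simp
  have h2 : ∀ v, ⟪oneVec μ, defectOperator (star (cnuContraction μ)) v⟫_ℂ = ⟪oneVec μ, v⟫_ℂ := by
    intro v
    rw [cnuContraction, hD.2, InnerProductSpace.rankOne_apply, inner_smul_right,
      inner_self_eq_norm_sq_to_K, norm_oneVec]
    simp
  have h : characteristicOperator (cnuContraction μ) z (conjVec μ) =
      -(cnuContraction μ (conjVec μ)) + z • (defectOperator (star (cnuContraction μ))
        (Ring.inverse (1 - z • star (cnuContraction μ))
          (defectOperator (cnuContraction μ) (conjVec μ)))) := rfl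
  rw [characteristicFunction, h, cnuContraction_conjVec, neg_zero, zero_add, inner_smul_right,
    h2, h1]

/-- The Clark measure identity: `(1 + conj γ θ) / (1 - conj γ θ)` is the Herglotz integral of
`μ_γ`. -/
theorem one_sub_characteristicFunction_mul (γ : Circle) {z : ℂ} (hz : ‖z‖ < 1) :
    (1 - conj (γ : ℂ) * characteristicFunction μ z) *
      (1 + ∫ w : Circle, ((w : ℂ) + z) / ((w : ℂ) - z) ∂(perturbedMeasure μ γ)) = 2 := by
  rw [perturbedMeasure, ← herglotz_spectralMeasure _ _ _ hz.ne, characteristicFunction_eq]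
  refine one_sub_characteristic_mul_one_add_herglotz (norm_cnuContraction_le_one μ)
    (rankOnePerturbation μ γ).2 rfl ?_ (norm_oneVec μ) ?_ hz
  · rw [mul_comm, Complex.mul_conj, Circle.normSq_coe, Complex.ofReal_one]
  · change cnuContraction μ (conjVec μ) + (γ : ℂ) • ⟪conjVec μ, conjVec μ⟫_ℂ • oneVec μ = _
    rw [cnuContraction_conjVec, inner_self_eq_norm_sq_to_K, norm_conjVec]
    simp

instance perturbedMeasure.instIsFiniteMeasure (γ : Circle) :
    IsFiniteMeasure (perturbedMeasure μ γ) :=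
  inferInstanceAs (IsFiniteMeasure (spectralMeasure _ _))

/-- As `|γ| = 1`, `|θ - γ| = |1 - conj γ θ| = 2 / |1 + F|`, and `|1 + F| ≥ 1 + Re F`. -/
theorem norm_characteristicFunction_sub_le (γ : Circle) {z : ℂ} (hz : ‖z‖ < 1) {M : ℝ}
    (hM : 0 < M)
    (h : M ≤ (∫ w : Circle, ((w : ℂ) + z) / ((w : ℂ) - z) ∂(perturbedMeasure μ γ)).re) :
    ‖characteristicFunction μ z - γ‖ ≤ 2 / M := by
  have h1 := one_sub_characteristicFunction_mul μ γ hz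
  set F := ∫ w : Circle, ((w : ℂ) + z) / ((w : ℂ) - z) ∂(perturbedMeasure μ γ)
  have hγ : (γ : ℂ) * conj (γ : ℂ) = 1 := by
    rw [Complex.mul_conj, Circle.normSq_coe, Complex.ofReal_one]
  have h2 : γ - characteristicFunction μ z =
      γ * (1 - conj (γ : ℂ) * characteristicFunction μ z) := by
    linear_combination characteristicFunction μ z * hγ
  have h3 := congrArg norm h1
  rw [norm_mul, Complex.norm_ofNat] at h3
  have h4 : M ≤ ‖1 + F‖ := by
    refine le_trans ?_ (Complex.re_le_norm _)
    rw [Complex.add_re, Complex.one_re]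
    linarith
  rw [norm_sub_rev, h2, norm_mul, Circle.norm_coe, one_mul, le_div_iff₀ hM, ← h3]
  gcongr

end RankOne

theorem mainTheorem10 (μ : Measure Circle) [IsProbabilityMeasure μ] (γ : Circle) :
    ∀ᵐ ζ ∂((perturbedMeasure μ γ).singularPart circleLebesgue),
      HasNontangentialLimit (characteristicFunction μ) ζ (γ : ℂ) := by
  set ν := perturbedMeasure μ γ
  filter_upwards [ae_eventually_mul_le_measureReal_closedBall (ν.singularPart circleLebesgue)
    (Measure.mutuallySingular_singularPart _ _).symm] with ζ hζ a ha
  rw [Metric.tendsto_nhds]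
  intro ε hε
  have hr : Tendsto (fun z : ℂ => 1 - ‖z‖)
      (𝓝[{z : ℂ | ‖z‖ < 1 ∧ ‖z - (ζ : ℂ)‖ < a * (1 - ‖z‖)}] (ζ : ℂ)) (𝓝[>] 0) := by
    refine tendsto_nhdsWithin_iff.mpr ⟨?_, ?_⟩
    · have hc : Continuous fun z : ℂ => 1 - ‖z‖ := by fun_prop
      have h := hc.tendsto (ζ : ℂ)
      rw [Circle.norm_coe, sub_self] at h
      exact h.mono_left nhdsWithin_le_nhds
    · filter_upwards [self_mem_nhdsWithin] with z hz
      exact sub_pos.mpr hz.1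
  -- The factor `(1 + a) ^ 2` absorbs the loss in the Poisson bound; `Re F ≥ 4 / ε` then gives a
  -- distance of at most `ε / 2`.
  filter_upwards [hr.eventually (hζ (4 / ε * (1 + a) ^ 2)), self_mem_nhdsWithin] with z h1 hz
  have hz0 : 0 < 1 - ‖z‖ := sub_pos.mpr hz.1
  have h2 : 4 / ε ≤ (∫ w : Circle, ((w : ℂ) + z) / ((w : ℂ) - z) ∂ν).re := by
    refine le_trans ?_ (measureReal_closedBall_div_le_re_herglotz ν ζ hz.1 hz.2)
    rw [le_div_iff₀ (by positivity), ← mul_assoc]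
    refine h1.trans ?_
    exact ENNReal.toReal_mono (measure_ne_top _ _) (Measure.singularPart_le ν circleLebesgue _)
  have h3 := norm_characteristicFunction_sub_le μ γ hz.1 (by positivity) h2
  rw [dist_eq_norm]
  refine h3.trans_lt ?_
  rw [div_div_eq_mul_div, div_lt_iff₀ (by norm_num)]
  linarith
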